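/- A finite family $\mathcal F$ of sets in $\mathbb{R}^2$ is \emph{pierced by $k$ lines} if there exist $k$ lines in $\mathbb{R}^2$ whose union intersects every set in $\mathcal F$. \textbf{Theorem.} Let $\mathcal F_1,\dots,\mathcal F_{2k}$ be finite families of compact convex sets in $\mathbb{R}^2$ such that for every choice of sets $F_i\in\mathcal F_i$, $i\in\{1,\dots,2k\}$, there are two distinct indices $i\ne j$ with $F_i\cap F_j\neq\emptyset$. Then there exists $i\in\{1,\dots,2k\}$ such that $\mathcal F_i$ is pierced by $k$ lines. -/

import Mathlib

/-- The Euclidean plane. -/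
abbrev Plane : Type := EuclideanSpace ℝ (Fin 2)

/-- A line in the plane: an affine subspace of dimension one.
(The empty affine subspace has direction of dimension zero, so it is excluded.) -/
def IsLine (l : AffineSubspace ℝ Plane) : Prop :=
  Module.finrank ℝ l.direction = 1

/-- A family of planar sets is pierced by `k` lines: there are `k` (distinct) lines
whose union intersects every set of the family. -/
def PiercedByLines (𝓕 : Set (Set Plane)) (k : ℕ) : Prop :=
  ∃ L : Finset (AffineSubspace ℝ Plane), L.card = k ∧ (∀ l ∈ L, IsLine l) ∧
    ∀ S ∈ 𝓕, (S ∩ ⋃ l ∈ L, (l : Set Plane)).Nonempty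

/-!
Suppose that no family is pierced by `k` lines, and let all sets lie in the open disc of radius `R`.
A point `x` of the simplex with `2 * k` vertices divides the circle of radius `R` into `2 * k` arcs
of lengths proportional to the coordinates of `x`. The `k` chords that join opposite dividing points
(`diagonal`) are lines that miss some set `S` of each family. As `S` is convex, it lies on one side
of each of them. Continuing the chords cyclically, the `(m + k)`-th one being the `m`-th one with the
opposite orientation, the signs of `S` change from positive to negative at some index `i`: the set
`S` lies in the wedge between the `i`-th and the `(i + 1)`-st chord that contains the `i`-th arc. Let
`i` be the first such index. If the `i`-th arc is a point, then the wedge misses the disc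
(`pos_of_mem_wedge`), so that `x i > 0`. Moreover sets with different indices lie on different sides
of some chord and are disjoint (`IsFirstDrop.disjoint`).

For each family the points `x` for which it has a set with index `i` form open sets that cover the
simplex in the way required by the colourful KKM theorem (`exists_perm_forall_mem_of_open_covers`).
That theorem gives a point `x` at which sets from the different families can be chosen with
pairwise different indices; they are pairwise disjoint, a contradiction.

The colourful KKM theorem follows from Birkhoff's theorem on doubly stochastic matrices and a dual
KKM theorem (`exists_mem_closed_cover_of_facets`). The latter is derived from Scarf's combinatorial
lemma (`scarf`), which replaces Sperner's lemma and needs no triangulation: dominant sets with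
respect to finitely many linear orders play the role of the simplices.
-/

/-! ### Scarf's lemma on finitely many linear orders -/

/-- A set `τ` is dominant for the orders `r i` if every `y` lies, in one of these orders, below
all of `τ`. -/
def IsDominant {I V α : Type*} [LE α] (r : I → V → α) (τ : Finset V) : Prop :=
  ∀ y, ∃ i, ∀ x ∈ τ, r i y ≤ r i x

lemma IsDominant.mono {I V α : Type*} [LE α] {r : I → V → α} {σ τ : Finset V}
    (h : IsDominant r τ) (hst : σ ⊆ τ) : IsDominant r σ := fun y ↦
  let ⟨i, hi⟩ := h y
  ⟨i, fun x hx ↦ hi x (hst hx)⟩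

section Scarf

variable {I V α : Type*} [Fintype I] [DecidableEq I] [DecidableEq V] [LinearOrder α]

/-- A map from a finite type onto a set with one element less identifies exactly one pair of
points. -/
lemma exists_unique_collision {p : I → V} {δ : Finset V} (hp : ∀ i, p i ∈ δ)
    (hsurj : ∀ x ∈ δ, ∃ i, p i = x) (hcard : δ.card + 1 = Fintype.card I) :
    ∃ a b, a ≠ b ∧ p a = p b ∧
      ∀ i j, i ≠ j → p i = p j → (i = a ∧ j = b) ∨ (i = b ∧ j = a) := by
  obtain ⟨a, -, b, -, hab, hpab⟩ := Finset.exists_ne_map_eq_of_card_lt_of_maps_to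
    (s := (Finset.univ : Finset I)) (t := δ) (by rw [Finset.card_univ]; omega)
    (f := p) (fun i _ ↦ hp i)
  have key : ∀ a b : I, a ≠ b → p a = p b → Set.InjOn p (Finset.univ.erase a : Finset I) := by
    intro a b hab hpab
    apply Finset.injOn_of_card_image_eq
    have h1 : (Finset.univ.erase a).image p = δ := by
      ext x
      simp only [Finset.mem_image, Finset.mem_erase, Finset.mem_univ, and_true]
      constructor
      · rintro ⟨i, -, rfl⟩
        exact hp i
      · intro hx
        obtain ⟨i, rfl⟩ := hsurj x hx
        by_cases hia : i = a
        · exact ⟨b, hab.symm, by rw [hia, hpab]⟩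
        · exact ⟨i, hia, rfl⟩
    rw [h1, Finset.card_erase_of_mem (Finset.mem_univ _), Finset.card_univ]
    omega
  refine ⟨a, b, hab, hpab, fun i j hij hpij ↦ ?_⟩
  have ha : i = a ∨ j = a := by
    by_contra! h
    exact hij (key a b hab hpab (by simpa using h.1) (by simpa using h.2) hpij)
  have hb : i = b ∨ j = b := by
    by_contra! h
    exact hij (key b a hab.symm hpab.symm (by simpa using h.1) (by simpa using h.2) hpij)
  grind

open Classical in
/-- The pivoting step. Let `δ` be a dominant set with `card I - 1` elements such that for each `a`
some element `e a` exceeds the least element of `δ` in every order other than the `a`-th. Then `δ`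
extends to exactly two dominant sets with `card I` elements. If `p i` is the least element of `δ`
in the `i`-th order, then `p` identifies exactly two indices `a` and `b`; the two extensions add
the element that is largest in the order `a` (respectively `b`) among those that exceed `p i` in
all other orders `i`. -/
lemma even_card_dominant_extensions [Fintype V] {r : I → V → α} (hr : ∀ i, Function.Injective (r i))
    {δ : Finset V} (hδ : IsDominant r δ) (hne : δ.Nonempty)
    (hcard : δ.card + 1 = Fintype.card I) (e : I → V)
    (he : ∀ a i, i ≠ a → ∃ x ∈ δ, r i x < r i (e a)) :
    Even (Finset.univ.filter fun y ↦ y ∉ δ ∧ IsDominant r (insert y δ)).card := by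
  choose p hpδ hpmin using fun i ↦ δ.exists_min_image (r i) hne
  have hpeq : ∀ i x, x ∈ δ → (∀ z ∈ δ, r i x ≤ r i z) → p i = x := fun i x hx h ↦
    hr i (le_antisymm (hpmin i x hx) (h _ (hpδ i)))
  have hsurj : ∀ x ∈ δ, ∃ i, p i = x := fun x hx ↦
    let ⟨i, hi⟩ := hδ x
    ⟨i, hpeq i x hx hi⟩
  obtain ⟨a, b, hab, hpab, huniq⟩ := exists_unique_collision hpδ hsurj hcard
  let M : I → V → Prop := fun a y ↦ ∀ i, i ≠ a → r i (p i) < r i y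
  have hmax : ∀ a, ∃ y, M a y ∧ ∀ z, M a z → r a z ≤ r a y := by
    intro a
    have hMa : M a (e a) := fun i hi ↦
      let ⟨x, hx, hlt⟩ := he a i hi
      (hpmin i x hx).trans_lt hlt
    obtain ⟨y, hy, hy'⟩ := (Finset.univ.filter (M a)).exists_max_image (r a)
      ⟨e a, by simpa using hMa⟩
    exact ⟨y, by simpa using hy, fun z hz ↦ hy' z (by simpa using hz)⟩
  obtain ⟨ya, hya, hya'⟩ := hmax a
  obtain ⟨yb, hyb, hyb'⟩ := hmax b
  have hext : ∀ a b y, a ≠ b → p a = p b → M a y → (∀ z, M a z → r a z ≤ r a y) →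
      y ∉ δ ∧ IsDominant r (insert y δ) := by
    intro a b y hab hpab hy hy'
    refine ⟨fun hyδ ↦ ?_, fun z ↦ ?_⟩
    · obtain ⟨i, hi⟩ := hsurj y hyδ
      by_cases hia : i = a
      · exact (hy b hab.symm).ne (by rw [← hpab, ← hia, hi])
      · exact (hy i hia).ne (by rw [hi])
    · by_cases hz : M a z
      · obtain ⟨i, hi⟩ := hδ y
        have hia : i = a := by
          by_contra hia
          exact (hy i hia).not_ge (hi _ (hpδ i))
        subst hia
        refine ⟨i, fun x hx ↦ ?_⟩
        rcases Finset.mem_insert.1 hx with rfl | hx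
        · exact hy' z hz
        · exact (hy' z hz).trans (hi x hx)
      · simp only [M, not_forall, not_lt] at hz
        obtain ⟨i, hia, hi⟩ := hz
        refine ⟨i, fun x hx ↦ ?_⟩
        rcases Finset.mem_insert.1 hx with rfl | hx
        · exact hi.trans (hy i hia).le
        · exact hi.trans (hpmin i x hx)
  have hpair : (Finset.univ.filter fun y ↦ y ∉ δ ∧ IsDominant r (insert y δ)) = {ya, yb} := by
    ext y
    simp only [Finset.mem_filter, Finset.mem_univ, true_and, Finset.mem_insert,
      Finset.mem_singleton]
    constructor
    · rintro ⟨hyδ, hdom⟩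
      obtain ⟨i₀, hi₀⟩ := hdom y
      -- every element of `δ` is still the least one in some order, which is not `i₀`
      have hstill : ∀ w ∈ δ, ∃ i, i ≠ i₀ ∧ p i = w ∧ r i w < r i y := by
        intro w hw
        obtain ⟨i, hi⟩ := hdom w
        have hwy : w ≠ y := fun h ↦ hyδ (h ▸ hw)
        have hlt : r i w < r i y :=
          lt_of_le_of_ne (hi y (Finset.mem_insert_self _ _)) fun h ↦ hwy (hr i h)
        refine ⟨i, ?_, hpeq i w hw fun z hz ↦ hi z (Finset.mem_insert_of_mem hz), hlt⟩
        rintro rfl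
        exact hlt.not_ge (hi₀ w (Finset.mem_insert_of_mem hw))
      have hi₀ab : i₀ = a ∨ i₀ = b := by
        obtain ⟨i, hne', hpi, -⟩ := hstill (p i₀) (hpδ i₀)
        rcases huniq i i₀ hne' hpi with h | h
        · exact Or.inr h.2
        · exact Or.inl h.2
      have hM : M i₀ y := by
        intro i hi
        obtain ⟨i', hi', hpi', hlt⟩ := hstill (p i) (hpδ i)
        by_cases hii : i' = i
        · rwa [hii] at hlt
        · rcases huniq i' i hii hpi' with h | h <;> grind
      have hM' : ∀ z, M i₀ z → r i₀ z ≤ r i₀ y := by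
        intro z hz
        obtain ⟨i, hi⟩ := hdom z
        by_cases hii : i = i₀
        · subst hii
          exact hi y (Finset.mem_insert_self _ _)
        · exact absurd (hi _ (Finset.mem_insert_of_mem (hpδ i))) (hz i hii).not_ge
      rcases hi₀ab with rfl | rfl
      · exact Or.inl (hr i₀ (le_antisymm (hya' y hM) (hM' ya hya)))
      · exact Or.inr (hr i₀ (le_antisymm (hyb' y hM) (hM' yb hyb)))
    · rintro (rfl | rfl)
      · exact hext a b y hab hpab hya hya'
      · exact hext b a y hab.symm hpab.symm hyb hyb'
  have hyab : ya ≠ yb := by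
    rintro rfl
    obtain ⟨i, hi⟩ := hδ ya
    have h1 : i = a := by
      by_contra h
      exact (hya i h).not_ge (hi _ (hpδ i))
    have h2 : i = b := by
      by_contra h
      exact (hyb i h).not_ge (hi _ (hpδ i))
    exact hab (h1.symm.trans h2)
  rw [hpair, Finset.card_pair hyab]
  exact even_two

/-- A set with as many elements as there are colours, but not showing all colours, has an even
number of elements (none or two) whose removal leaves precisely the colours other than `i₀`. -/
lemma even_card_erase_image {τ : Finset V} {c : V → I} (hcard : τ.card = Fintype.card I)
    (hτ : τ.image c ≠ Finset.univ) (i₀ : I) :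
    Even (τ.filter fun x ↦ (τ.erase x).image c = Finset.univ.erase i₀).card := by
  rcases Finset.eq_empty_or_nonempty
    (τ.filter fun x ↦ (τ.erase x).image c = Finset.univ.erase i₀) with h | ⟨x, hx⟩
  · simp [h]
  obtain ⟨hxτ, hximg⟩ := Finset.mem_filter.1 hx
  have himg : τ.image c = insert (c x) (Finset.univ.erase i₀) := by
    rw [← hximg, ← Finset.image_insert, Finset.insert_erase hxτ]
  have hcx : c x ≠ i₀ := by
    intro h
    rw [h, Finset.insert_erase (Finset.mem_univ _)] at himg
    exact hτ himg
  have hinj : Set.InjOn c (τ.erase x : Finset V) := by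
    apply Finset.injOn_of_card_image_eq
    rw [hximg, Finset.card_erase_of_mem hxτ, Finset.card_erase_of_mem (Finset.mem_univ _), hcard,
      Finset.card_univ]
  obtain ⟨x', hx', hcx'⟩ : ∃ x' ∈ τ.erase x, c x' = c x := by
    rw [← Finset.mem_image, hximg]
    simpa using hcx
  obtain ⟨hne, hx'τ⟩ := Finset.mem_erase.1 hx'
  have hpair : (τ.filter fun x ↦ (τ.erase x).image c = Finset.univ.erase i₀) = {x, x'} := by
    ext w
    simp only [Finset.mem_filter, Finset.mem_insert, Finset.mem_singleton]
    constructor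
    · rintro ⟨hw, hwimg⟩
      by_contra! hcon
      have : c w ∈ (τ.erase w).image c := by
        rw [hwimg, ← hximg]
        exact Finset.mem_image_of_mem _ (Finset.mem_erase.2 ⟨hcon.1, hw⟩)
      obtain ⟨v, hv, hcv⟩ := Finset.mem_image.1 this
      obtain ⟨hvw, hvτ⟩ := Finset.mem_erase.1 hv
      by_cases hvx : v = x
      · subst hvx
        exact hcon.2 (hinj (by simpa using ⟨hw, hcon.1⟩) (by simpa using ⟨hx'τ, hne⟩)
          (by rw [hcx', hcv]))
      · exact hvw (hinj (by simpa using ⟨hvτ, hvx⟩) (by simpa using ⟨hw, hcon.1⟩) hcv)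
    · rintro (rfl | rfl)
      · exact ⟨hxτ, hximg⟩
      · refine ⟨hx'τ, ?_⟩
        rw [← hximg]
        ext i
        simp only [Finset.mem_image, Finset.mem_erase]
        constructor
        · rintro ⟨v, ⟨hv, hvτ⟩, rfl⟩
          by_cases hvx : v = x
          · exact ⟨w, ⟨hne, hx'τ⟩, by rw [hvx, hcx']⟩
          · exact ⟨v, ⟨hvx, hvτ⟩, rfl⟩
        · rintro ⟨v, ⟨hv, hvτ⟩, rfl⟩
          by_cases hvx : v = w
          · exact ⟨x, ⟨hne.symm, hxτ⟩, by rw [hvx, hcx']⟩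
          · exact ⟨v, ⟨hvx, hvτ⟩, rfl⟩
  rw [hpair, Finset.card_pair hne.symm]
  exact even_two

open Classical in
/-- Scarf's lemma with outer elements. The element `e i` is the least one in the `i`-th order and
exceeds all non-outer elements in the other orders, so a dominant set with `card I - 1` elements
can have an odd number of dominant extensions only if it consists of outer elements. Just one such
set shows all colours but `i₀`. As in Sperner's lemma, counting by parity the extensions of the
dominant sets with these colours produces a dominant set with all colours. -/
lemma exists_dominant_rainbow [Fintype V] [Nonempty I] {r : I → V → α}
    (hr : ∀ i, Function.Injective (r i))
    {e : I → V} (heinj : Function.Injective e) (hmin : ∀ i v, v ≠ e i → r i (e i) < r i v)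
    (hbig : ∀ i j, j ≠ i → ∀ v, v ∉ Set.range e → r i v < r i (e j))
    (hinner : ∃ v, v ∉ Set.range e) {c : V → I} (hc : ∀ i, c (e i) = i) :
    ∃ τ : Finset V, IsDominant r τ ∧ τ.image c = Finset.univ := by
  by_contra! hcon
  obtain ⟨i₀⟩ := ‹Nonempty I›
  obtain ⟨v₀, hv₀⟩ := hinner
  have hpos : 0 < Fintype.card I := Fintype.card_pos_iff.2 ⟨i₀⟩
  let doors : Finset (Finset V) := Finset.univ.filter fun δ ↦
    IsDominant r δ ∧ δ.image c = Finset.univ.erase i₀ ∧ δ.card + 1 = Fintype.card I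
  let rooms : Finset (Finset V) := Finset.univ.filter fun τ ↦
    IsDominant r τ ∧ τ.card = Fintype.card I
  let ext : Finset V → Finset V := fun δ ↦
    Finset.univ.filter fun y ↦ y ∉ δ ∧ IsDominant r (insert y δ)
  let faces : Finset V → Finset V := fun τ ↦
    τ.filter fun x ↦ (τ.erase x).image c = Finset.univ.erase i₀
  have hcount : (doors.sigma ext).card = (rooms.sigma faces).card := by
    refine Finset.card_nbij' (fun q ↦ ⟨insert q.2 q.1, q.2⟩) (fun q ↦ ⟨q.1.erase q.2, q.2⟩)
      ?_ ?_ ?_ ?_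
    · rintro ⟨δ, y⟩ h
      simp only [Finset.coe_sigma, Set.mem_sigma_iff, Finset.mem_coe, doors, ext, rooms, faces,
        Finset.mem_filter, Finset.mem_univ, true_and] at h ⊢
      obtain ⟨⟨-, himg, hcard⟩, hy, hdom⟩ := h
      refine ⟨⟨hdom, by rw [Finset.card_insert_of_notMem hy, hcard]⟩,
        Finset.mem_insert_self _ _, by rw [Finset.erase_insert hy, himg]⟩
    · rintro ⟨τ, x⟩ h
      simp only [Finset.coe_sigma, Set.mem_sigma_iff, Finset.mem_coe, doors, ext, rooms, faces,
        Finset.mem_filter, Finset.mem_univ, true_and] at h ⊢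
      obtain ⟨⟨hdom, hcard⟩, hx, himg⟩ := h
      refine ⟨⟨hdom.mono (Finset.erase_subset _ _), himg, ?_⟩, Finset.notMem_erase _ _, ?_⟩
      · rw [Finset.card_erase_of_mem hx]
        omega
      · rwa [Finset.insert_erase hx]
    · rintro ⟨δ, y⟩ h
      simp only [Finset.coe_sigma, Set.mem_sigma_iff, Finset.mem_coe, doors, ext,
        Finset.mem_filter, Finset.mem_univ, true_and] at h
      simp [Finset.erase_insert h.2.1]
    · rintro ⟨τ, x⟩ h
      simp only [Finset.coe_sigma, Set.mem_sigma_iff, Finset.mem_coe, rooms, faces,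
        Finset.mem_filter, Finset.mem_univ, true_and] at h
      simp [Finset.insert_erase h.2.1]
  rw [Finset.card_sigma, Finset.card_sigma] at hcount
  have hrooms : Even (∑ τ ∈ rooms, (faces τ).card) := by
    refine Finset.even_sum _ fun τ hτ ↦ ?_
    obtain ⟨hdom, hcard⟩ := (Finset.mem_filter.1 hτ).2
    exact even_card_erase_image hcard (hcon τ hdom) i₀
  -- the outer door
  let δ₀ : Finset V := (Finset.univ.erase i₀).image e
  have hmem₀ : ∀ j, j ≠ i₀ → e j ∈ δ₀ := fun j hj ↦
    Finset.mem_image_of_mem _ (by simpa using hj)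
  have hcard₀ : δ₀.card + 1 = Fintype.card I := by
    rw [Finset.card_image_of_injective _ heinj, Finset.card_erase_of_mem (Finset.mem_univ _),
      Finset.card_univ]
    omega
  have hv₀δ : v₀ ∉ δ₀ := fun h ↦
    let ⟨j, _, hj⟩ := Finset.mem_image.1 h
    hv₀ ⟨j, hj⟩
  have hext₀ : (ext δ₀).card = 1 := by
    obtain ⟨y, hy, hymax⟩ := (Finset.univ.filter fun y ↦ y ∉ δ₀).exists_max_image (r i₀)
      ⟨v₀, by simpa using hv₀δ⟩
    simp only [Finset.mem_filter, Finset.mem_univ, true_and] at hy hymax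
    rw [Finset.card_eq_one]
    refine ⟨y, ?_⟩
    ext y'
    simp only [ext, Finset.mem_filter, Finset.mem_univ, true_and, Finset.mem_singleton]
    constructor
    · rintro ⟨hy', hdom⟩
      obtain ⟨i, hi⟩ := hdom y
      have hii : i = i₀ := by
        by_contra hii
        have h1 := hi (e i) (Finset.mem_insert_of_mem (hmem₀ i hii))
        have h2 : y = e i := by
          by_contra h
          exact (hmin i y h).not_ge h1
        exact hy (h2 ▸ hmem₀ i hii)
      subst hii
      exact hr i (le_antisymm (hymax y' hy') (hi y' (Finset.mem_insert_self _ _)))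
    · rintro rfl
      refine ⟨hy, fun z ↦ ?_⟩
      by_cases hz : z ∈ δ₀
      · obtain ⟨j, hj, rfl⟩ := Finset.mem_image.1 hz
        refine ⟨j, fun x _ ↦ ?_⟩
        by_cases hx : x = e j
        · rw [hx]
        · exact (hmin j x hx).le
      · refine ⟨i₀, fun x hx ↦ ?_⟩
        rcases Finset.mem_insert.1 hx with rfl | hx
        · exact hymax z hz
        · obtain ⟨j, hj, rfl⟩ := Finset.mem_image.1 hx
          have hj : j ≠ i₀ := by simpa using hj
          by_cases hzr : z ∈ Set.range e
          · obtain ⟨l, rfl⟩ := hzr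
            have hl : l = i₀ := by
              by_contra h
              exact hz (hmem₀ l h)
            subst hl
            exact (hmin l _ fun h ↦ hj (heinj h)).le
          · exact (hbig i₀ j hj z hzr).le
  have hdoor₀ : δ₀ ∈ doors := by
    obtain ⟨y, hy⟩ := Finset.card_pos.1 (by rw [hext₀]; exact one_pos : 0 < (ext δ₀).card)
    simp only [ext, Finset.mem_filter, Finset.mem_univ, true_and] at hy
    simp only [doors, Finset.mem_filter, Finset.mem_univ, true_and]
    refine ⟨hy.2.mono (Finset.subset_insert _ _), ?_, hcard₀⟩
    rw [Finset.image_image]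
    ext i
    simp [hc]
  have hdoors : Even (∑ δ ∈ doors.erase δ₀, (ext δ).card) := by
    refine Finset.even_sum _ fun δ hδ ↦ ?_
    obtain ⟨hδne, hδ⟩ := Finset.mem_erase.1 hδ
    obtain ⟨hdom, himg, hcard⟩ := (Finset.mem_filter.1 hδ).2
    have hne : δ.Nonempty := by
      rw [Finset.nonempty_iff_ne_empty]
      rintro rfl
      have : δ₀ = ∅ := by
        rw [← Finset.card_eq_zero]
        simp only [Finset.card_empty] at hcard
        omega
      exact hδne this.symm
    refine even_card_dominant_extensions hr hdom hne hcard e fun a i hia ↦ ?_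
    by_contra! hle
    apply hδne
    have hsub : δ ⊆ (Finset.univ.erase i).image e := by
      intro x hx
      have hxr : x ∈ Set.range e := by
        by_contra h
        exact (hbig i a hia.symm x h).not_ge (hle x hx)
      obtain ⟨l, rfl⟩ := hxr
      refine Finset.mem_image_of_mem _ (Finset.mem_erase.2 ⟨?_, Finset.mem_univ _⟩)
      rintro rfl
      exact (hmin l (e a) fun h ↦ hia (heinj h).symm).not_ge (hle _ hx)
    have heq : δ = (Finset.univ.erase i).image e := by
      apply Finset.eq_of_subset_of_card_le hsub
      rw [Finset.card_image_of_injective _ heinj, Finset.card_erase_of_mem (Finset.mem_univ _),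
        Finset.card_univ]
      omega
    have hi : i = i₀ := by
      rw [heq, Finset.image_image] at himg
      by_contra h
      have : i₀ ∈ (Finset.univ.erase i).image (c ∘ e) :=
        Finset.mem_image.2 ⟨i₀, by simpa using fun h' : i₀ = i ↦ h h'.symm, hc i₀⟩
      rw [himg] at this
      simp at this
    rw [heq, hi]
  rw [← Finset.add_sum_erase _ _ hdoor₀, hext₀] at hcount
  rw [← hcount, Nat.even_add] at hrooms
  exact Nat.not_even_one (hrooms.2 hdoors)

end Scarf

/-- Scarf's lemma for weights. Ties in the weights are broken by an arbitrary enumeration, and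
one outer element is added for each index. -/
theorem scarf {I T : Type*} [Fintype I] [Nonempty I] [Fintype T] [Nonempty T]
    (w : I → T → ℕ) (c : T → I) :
    ∃ (C : Finset I) (x : I → T), C.Nonempty ∧ (∀ i ∈ C, c (x i) = i) ∧
      ∀ y, ∃ i ∈ C, ∀ j ∈ C, w i y ≤ w i (x j) := by
  classical
  let B : ℕ := ∑ i, ∑ t, w i t + 2
  have hB : ∀ i t, w i t + 1 < B := by
    intro i t
    have h1 : w i t ≤ ∑ t, w i t :=
      Finset.single_le_sum (f := fun t ↦ w i t) (fun _ _ ↦ Nat.zero_le _) (Finset.mem_univ t)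
    have h2 : ∑ t, w i t ≤ ∑ i, ∑ t, w i t :=
      Finset.single_le_sum (f := fun i ↦ ∑ t, w i t) (fun _ _ ↦ Nat.zero_le _) (Finset.mem_univ i)
    omega
  let val : I → T ⊕ I → ℕ := fun i ↦ Sum.elim (fun t ↦ w i t + 1) fun j ↦ if j = i then 0 else B
  let r : I → T ⊕ I → ℕ ×ₗ ℕ := fun i v ↦ toLex (val i v, (Fintype.equivFin (T ⊕ I) v : ℕ))
  have hlt : ∀ i v v', val i v < val i v' → r i v < r i v' := fun i v v' h ↦
    Prod.Lex.toLex_lt_toLex.2 (Or.inl h)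
  have hle : ∀ i v v', r i v ≤ r i v' → val i v ≤ val i v' := fun i v v' h ↦ by
    rcases Prod.Lex.toLex_le_toLex.1 h with h | h
    · exact le_of_lt h
    · exact h.1.le
  obtain ⟨τ, hdom, himg⟩ := exists_dominant_rainbow (r := r) (e := Sum.inr)
    (c := Sum.elim c id)
    (fun i v v' h ↦ by
      have := congrArg (fun q ↦ (ofLex q).2) h
      exact (Fintype.equivFin _).injective (Fin.ext this))
    Sum.inr_injective
    (fun i v hv ↦ hlt i _ _ (by
      rcases v with t | j
      · simp [val]
      · have : j ≠ i := fun h ↦ hv (by rw [h])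
        simp [val, this, B]))
    (fun i j hj v hv ↦ hlt i _ _ (by
      rcases v with t | l
      · simpa [val, hj] using hB i t
      · exact absurd ⟨l, rfl⟩ hv))
    ⟨Sum.inl (Classical.arbitrary T), by simp⟩ (fun i ↦ rfl)
  have hrain : ∀ i, ∃ v ∈ τ, Sum.elim c id v = i := fun i ↦ by
    rw [← Finset.mem_image, himg]
    exact Finset.mem_univ i
  have hx : ∀ i, ∃ t, Sum.inr i ∉ τ → Sum.inl t ∈ τ ∧ c t = i := by
    intro i
    obtain ⟨v, hv, hvi⟩ := hrain i
    rcases v with t | j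
    · exact ⟨t, fun _ ↦ ⟨hv, hvi⟩⟩
    · refine ⟨Classical.arbitrary T, fun h ↦ absurd hv ?_⟩
      rw [← hvi] at h
      exact h
  choose x hx using hx
  have hcell : ∀ y, ∃ i ∈ Finset.univ.filter fun i ↦ Sum.inr i ∉ τ,
      ∀ j ∈ Finset.univ.filter fun i ↦ Sum.inr i ∉ τ, w i y ≤ w i (x j) := by
    intro y
    obtain ⟨i, hi⟩ := hdom (Sum.inl y)
    refine ⟨i, ?_, fun j hj ↦ ?_⟩
    · simp only [Finset.mem_filter, Finset.mem_univ, true_and]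
      intro h
      simpa [val] using hle i _ _ (hi _ h)
    · simp only [Finset.mem_filter, Finset.mem_univ, true_and] at hj
      simpa [val] using hle i _ _ (hi _ (hx j hj).1)
  obtain ⟨i, hi, -⟩ := hcell (Classical.arbitrary T)
  exact ⟨_, x, ⟨i, hi⟩, fun i hi ↦ (hx i (by simpa using hi)).2, hcell⟩

/-! ### Covers of the simplex -/

/-- The dual Knaster–Kuratowski–Mazurkiewicz theorem: closed sets that cover the simplex, the
`i`-th of them containing the facet `x i = 0`, have a common point. Scarf's lemma is applied to the
points with coordinates in `ℕ / N`, ordered by their coordinates and coloured by the cover. -/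
theorem exists_mem_closed_cover_of_facets {I : Type*} [Fintype I] [Nonempty I]
    {B : I → Set (stdSimplex ℝ I)} (hB : ∀ i, IsClosed (B i)) (hcover : ∀ x, ∃ i, x ∈ B i)
    (hfacet : ∀ i (x : stdSimplex ℝ I), x.1 i = 0 → x ∈ B i) :
    ∃ x, ∀ i, x ∈ B i := by
  classical
  by_contra! hcon
  obtain ⟨δ, hδ, hball⟩ := lebesgue_number_lemma_of_metric (s := Set.univ)
    (c := fun i ↦ (B i)ᶜ) isCompact_univ (fun i ↦ (hB i).isOpen_compl)
    (fun x _ ↦ let ⟨i, hi⟩ := hcon x; Set.mem_iUnion.2 ⟨i, hi⟩)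
  set n := Fintype.card I
  obtain ⟨N, hN⟩ := exists_nat_gt ((n : ℝ) / δ)
  have hN0 : (0 : ℝ) < N := lt_of_le_of_lt (by positivity) hN
  have hnN : (n : ℝ) / N < δ := by
    rw [div_lt_iff₀ hδ] at hN
    rw [div_lt_iff₀ hN0]
    linarith
  let T := {a : I → ℕ // a ∈ Finset.piAntidiag Finset.univ N}
  have : Fintype T := inferInstanceAs (Fintype {a // a ∈ Finset.piAntidiag Finset.univ N})
  have hT : ∀ a : T, ∑ i, a.1 i = N := fun a ↦ (Finset.mem_piAntidiag.1 a.2).1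
  have hTle : ∀ (a : T) (s : Finset I), ∑ i ∈ s, a.1 i ≤ N := fun a s ↦
    (Finset.sum_le_sum_of_subset (Finset.subset_univ _)).trans (hT a).le
  have mkT : ∀ a : I → ℕ, ∑ i, a i = N → a ∈ Finset.piAntidiag Finset.univ N := fun a ha ↦
    Finset.mem_piAntidiag.2 ⟨ha, fun i _ ↦ Finset.mem_univ i⟩
  let i₁ : I := Classical.arbitrary I
  have : Nonempty T := ⟨⟨Pi.single i₁ N, mkT _ (by simp)⟩⟩
  let pt : T → stdSimplex ℝ I := fun a ↦ ⟨fun i ↦ (a.1 i : ℝ) / N, fun i ↦ by positivity, by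
    rw [← Finset.sum_div, ← Nat.cast_sum, hT, div_self hN0.ne']⟩
  have hdist : ∀ a b : T, (∀ i, a.1 i ≤ b.1 i + n ∧ b.1 i ≤ a.1 i + n) →
      dist (pt a) (pt b) < δ := by
    intro a b h
    refine lt_of_le_of_lt ?_ hnN
    rw [Subtype.dist_eq, dist_pi_le_iff (by positivity)]
    intro i
    obtain ⟨h1, h2⟩ := h i
    have h1' : (a.1 i : ℝ) ≤ b.1 i + n := by exact_mod_cast h1
    have h2' : (b.1 i : ℝ) ≤ a.1 i + n := by exact_mod_cast h2
    change dist ((a.1 i : ℝ) / N) ((b.1 i : ℝ) / N) ≤ n / N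
    rw [Real.dist_eq, ← sub_div, abs_div, abs_of_pos hN0]
    gcongr
    rw [abs_le]
    constructor <;> linarith
  choose c hc using fun a : T ↦ hcover (pt a)
  obtain ⟨C, x, ⟨j₀, hj₀⟩, hcol, hcell⟩ := scarf (fun i (a : T) ↦ a.1 i) c
  have hmin : ∀ i, ∃ j ∈ C, ∀ j' ∈ C, (x j).1 i ≤ (x j').1 i := fun i ↦
    C.exists_min_image (fun j ↦ (x j).1 i) ⟨j₀, hj₀⟩
  choose l hlC hl using hmin
  let m : I → ℕ := fun i ↦ (x (l i)).1 i
  have hm : ∀ i, ∀ j ∈ C, m i ≤ (x j).1 i := fun i j hj ↦ hl i j hj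
  -- otherwise some grid point would exceed the minima `m i` for all `i ∈ C`
  have hsum : N < ∑ i ∈ C, (m i + 1) := by
    by_contra! hle
    let y : I → ℕ := (fun i ↦ if i ∈ C then m i + 1 else 0) +
      Pi.single j₀ (N - ∑ i ∈ C, (m i + 1))
    have hy : ∑ i, y i = N := by
      simp only [y, Pi.add_apply, Finset.sum_add_distrib, Finset.sum_ite_mem, Finset.univ_inter,
        Finset.sum_pi_single', Finset.mem_univ, if_true]
      rw [← Finset.sum_add_distrib]
      omega
    obtain ⟨i, hi, hi'⟩ := hcell ⟨y, mkT y hy⟩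
    have h1 : y i ≤ m i := hi' _ (hlC i)
    have h2 : m i + 1 ≤ y i := by
      simp only [y, Pi.add_apply, if_pos hi]
      omega
    omega
  rw [Finset.sum_add_distrib, Finset.sum_const, smul_eq_mul, mul_one] at hsum
  have hCn : C.card ≤ n := Finset.card_le_univ C
  have hin : ∀ j ∈ C, ∀ i ∈ C, (x j).1 i ≤ m i + n := by
    intro j hj i hi
    have h1 := hTle (x j) C
    rw [← Finset.add_sum_erase _ _ hi] at h1 hsum
    have h2 : ∑ i' ∈ C.erase i, m i' ≤ ∑ i' ∈ C.erase i, (x j).1 i' :=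
      Finset.sum_le_sum fun i' _ ↦ hm i' j hj
    omega
  have hout : ∀ j ∈ C, ∀ i, i ∉ C → (x j).1 i ≤ n := by
    intro j hj i hi
    have h1 := hTle (x j) (insert i C)
    rw [Finset.sum_insert hi] at h1
    have h2 : ∑ i' ∈ C, m i' ≤ ∑ i' ∈ C, (x j).1 i' := Finset.sum_le_sum fun i' _ ↦ hm i' j hj
    omega
  obtain ⟨i, hi⟩ := hball (pt (x j₀)) (Set.mem_univ _)
  by_cases hiC : i ∈ C
  · have h1 := hc (x i)
    rw [hcol i hiC] at h1
    refine hi ?_ h1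
    rw [Metric.mem_ball]
    refine hdist _ _ fun i' ↦ ?_
    by_cases hi' : i' ∈ C
    · have := hin i hiC i' hi'
      have := hin j₀ hj₀ i' hi'
      have := hm i' i hiC
      have := hm i' j₀ hj₀
      omega
    · have := hout i hiC i' hi'
      have := hout j₀ hj₀ i' hi'
      omega
  · -- moving the small `i`-th coordinate to `j₀` leads to a nearby point of the facet
    have hij : i ≠ j₀ := fun h ↦ hiC (h ▸ hj₀)
    let z : I → ℕ := fun i' ↦ if i' = i then 0 else
      if i' = j₀ then (x j₀).1 j₀ + (x j₀).1 i else (x j₀).1 i'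
    have hz : ∑ i', z i' = N := by
      have hj₀i : j₀ ∈ Finset.univ.erase i := by simpa using hij.symm
      have h1 := hT (x j₀)
      rw [← Finset.add_sum_erase _ _ (Finset.mem_univ i),
        ← Finset.add_sum_erase _ _ hj₀i] at h1 ⊢
      have h2 : ∑ i' ∈ (Finset.univ.erase i).erase j₀, z i' =
          ∑ i' ∈ (Finset.univ.erase i).erase j₀, (x j₀).1 i' := by
        refine Finset.sum_congr rfl fun i' hi' ↦ ?_
        simp only [Finset.mem_erase, Finset.mem_univ, and_true] at hi'
        simp [z, hi'.1, hi'.2]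
      have h3 : z i = 0 := by simp [z]
      have h4 : z j₀ = (x j₀).1 j₀ + (x j₀).1 i := by simp [z, hij.symm]
      omega
    have hfac : pt ⟨z, mkT z hz⟩ ∈ B i := hfacet i _ (by simp [pt, z])
    refine hi ?_ hfac
    rw [Metric.mem_ball]
    refine hdist _ _ fun i' ↦ ?_
    have := hout j₀ hj₀ i hiC
    by_cases h1 : i' = i
    · subst h1
      simp only [z, if_true]
      omega
    · by_cases h2 : i' = j₀
      · subst h2
        simp only [z, h1, if_false, if_true]
        omega
      · simp only [z, h1, h2, if_false]
        omega

/-- Gale's colourful Knaster–Kuratowski–Mazurkiewicz theorem, for open covers. Averaging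
partitions of unity subordinate to the covers reduces it to a point at which their values form a
doubly stochastic matrix, which is a mean of permutation matrices. -/
theorem exists_perm_forall_mem_of_open_covers {I : Type*} [Fintype I] [Nonempty I]
    {A : I → I → Set (stdSimplex ℝ I)} (hA : ∀ c i, IsOpen (A c i))
    (hcover : ∀ c x, ∃ i, 0 < x.1 i ∧ x ∈ A c i) :
    ∃ (x : stdSimplex ℝ I) (π : Equiv.Perm I), ∀ c, x ∈ A c (π c) := by
  classical
  have hcont : ∀ i, Continuous fun x : stdSimplex ℝ I ↦ x.1 i := fun i ↦
    (continuous_apply i).comp continuous_subtype_val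
  have hU : ∀ c i, IsOpen (A c i ∩ {x | 0 < x.1 i}) := fun c i ↦
    (hA c i).inter (isOpen_lt continuous_const (hcont i))
  choose ρ hρ using fun c ↦ PartitionOfUnity.exists_isSubordinate
    (isClosed_univ (X := stdSimplex ℝ I)) (fun i ↦ A c i ∩ {x | 0 < x.1 i}) (hU c)
    (fun x _ ↦ let ⟨i, hi, hi'⟩ := hcover c x; Set.mem_iUnion.2 ⟨i, hi', hi⟩)
  have hsum : ∀ c x, ∑ i, ρ c i x = 1 := fun c x ↦ by
    rw [← finsum_eq_sum_of_fintype]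
    exact (ρ c).sum_eq_one (Set.mem_univ x)
  have hsupp : ∀ c i x, ρ c i x ≠ 0 → x ∈ A c i ∧ 0 < x.1 i := fun c i x h ↦
    hρ c i (subset_closure h)
  have htotal : ∀ x, ∑ i, ∑ c, ρ c i x = Fintype.card I := fun x ↦ by
    rw [Finset.sum_comm]
    simp [hsum]
  obtain ⟨x, hx⟩ := exists_mem_closed_cover_of_facets (I := I)
    (B := fun i ↦ {x | ∑ c, ρ c i x ≤ 1})
    (fun i ↦ isClosed_le (continuous_finsetSum _ fun c _ ↦ (ρ c i).continuous) continuous_const)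
    (fun x ↦ by
      by_contra! h
      simp only [Set.mem_ofPred_eq, not_le] at h
      have := Finset.sum_lt_sum_of_nonempty Finset.univ_nonempty fun i _ ↦ h i
      rw [htotal] at this
      simp at this)
    (fun i x hx ↦ by
      have : ∀ c, ρ c i x = 0 := fun c ↦ by
        by_contra h
        exact (hsupp c i x h).2.ne' hx
      simp [this])
  have hcol : ∀ i, ∑ c, ρ c i x = 1 := by
    have h := (Finset.sum_eq_sum_iff_of_le (s := Finset.univ) (f := fun i ↦ ∑ c, ρ c i x)
      (g := fun _ ↦ (1 : ℝ)) fun i _ ↦ hx i).1 (by rw [htotal]; simp)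
    exact fun i ↦ h i (Finset.mem_univ i)
  have hM : (Matrix.of fun c i ↦ ρ c i x) ∈ doublyStochastic ℝ I := by
    rw [mem_doublyStochastic_iff_sum]
    exact ⟨fun c i ↦ (ρ c).nonneg i x, fun c ↦ hsum c x, hcol⟩
  obtain ⟨w, hw0, hw1, hw⟩ := exists_eq_sum_perm_of_mem_doublyStochastic hM
  obtain ⟨π, -, hπ⟩ : ∃ π ∈ Finset.univ, 0 < w π :=
    (Finset.sum_pos_iff_of_nonneg fun π _ ↦ hw0 π).1 (by rw [hw1]; exact one_pos)
  refine ⟨x, π, fun c ↦ (hsupp c (π c) x ?_).1⟩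
  have hentry : ρ c (π c) x = ∑ σ, w σ * σ.permMatrix ℝ c (π c) := by
    have := congrFun (congrFun hw c) (π c)
    rw [Matrix.sum_apply] at this
    simpa using this.symm
  rw [hentry]
  refine (lt_of_lt_of_le hπ ?_).ne'
  refine le_trans ?_ (Finset.single_le_sum (f := fun σ ↦ w σ * σ.permMatrix ℝ c (π c))
    (fun σ _ ↦ mul_nonneg (hw0 σ) ?_) (Finset.mem_univ π))
  · simp [Equiv.Perm.permMatrix, PEquiv.toMatrix_apply]
  · simp only [Equiv.Perm.permMatrix, PEquiv.toMatrix_apply]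
    split_ifs <;> norm_num

/-! ### Chords of a circle -/

/-- The line `{z | z 0 * cos φ + z 1 * sin φ = t}`, with unit normal at angle `φ` and signed
distance `t` from the origin. -/
noncomputable def normalLine (φ t : ℝ) : AffineSubspace ℝ Plane :=
  AffineSubspace.mk' (t • !₂[Real.cos φ, Real.sin φ]) (ℝ ∙ (!₂[Real.cos φ, Real.sin φ] : Plane))ᗮ

lemma inner_cos_sin (φ : ℝ) (z : Plane) :
    inner ℝ (!₂[Real.cos φ, Real.sin φ] : Plane) z = z 0 * Real.cos φ + z 1 * Real.sin φ := by
  simp [PiLp.inner_apply, Fin.sum_univ_two]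

lemma mem_normalLine {φ t : ℝ} {z : Plane} :
    z ∈ normalLine φ t ↔ z 0 * Real.cos φ + z 1 * Real.sin φ = t := by
  rw [normalLine, AffineSubspace.mem_mk', Submodule.mem_orthogonal_singleton_iff_inner_right,
    vsub_eq_sub, inner_sub_right, inner_smul_right, inner_cos_sin, inner_cos_sin, sub_eq_zero]
  have : (!₂[Real.cos φ, Real.sin φ] : Plane) 0 * Real.cos φ +
      (!₂[Real.cos φ, Real.sin φ] : Plane) 1 * Real.sin φ = 1 := by
    simp only [Matrix.cons_val_zero, Matrix.cons_val_one]
    nlinarith [Real.cos_sq_add_sin_sq φ]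
  rw [this, mul_one]

lemma isLine_normalLine (φ t : ℝ) : IsLine (normalLine φ t) := by
  have : Fact (Module.finrank ℝ Plane = 1 + 1) := ⟨by simp⟩
  rw [IsLine, normalLine, AffineSubspace.direction_mk']
  refine Submodule.finrank_orthogonal_span_singleton fun h ↦ ?_
  have h0 : Real.cos φ = 0 := by simpa using congrArg (fun v : Plane ↦ v 0) h
  have h1 : Real.sin φ = 0 := by simpa using congrArg (fun v : Plane ↦ v 1) h
  simpa [h0, h1] using Real.cos_sq_add_sin_sq φ

lemma infinite_lines : Infinite {l // IsLine l} := by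
  refine Infinite.of_injective (fun t : ℝ ↦ ⟨normalLine 0 t, isLine_normalLine 0 t⟩)
    fun s t h ↦ ?_
  have hs : (!₂[s, 0] : Plane) ∈ normalLine 0 s := by simp [mem_normalLine]
  have hst : normalLine 0 s = normalLine 0 t := congrArg Subtype.val h
  rw [hst] at hs
  simpa [mem_normalLine] using hs

/-- Piercing by `k` lines that need not be distinct suffices, as further lines can be added. -/
lemma piercedByLines_of_forall_fin {𝓕 : Set (Set Plane)} {k : ℕ}
    (l : Fin k → AffineSubspace ℝ Plane) (hl : ∀ j, IsLine (l j))
    (h : ∀ S ∈ 𝓕, ∃ j, ∃ z ∈ S, z ∈ l j) : PiercedByLines 𝓕 k := by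
  classical
  have := infinite_lines
  let s : Finset {l // IsLine l} := Finset.univ.image fun j ↦ ⟨l j, hl j⟩
  obtain ⟨t, hst, ht⟩ := Infinite.exists_superset_card_eq s k
    (Finset.card_image_le.trans (by simp))
  refine ⟨t.map (Function.Embedding.subtype _), by rw [Finset.card_map, ht], ?_, ?_⟩
  · intro m hm
    obtain ⟨m', -, rfl⟩ := Finset.mem_map.1 hm
    exact m'.2
  · intro S hS
    obtain ⟨j, z, hz, hzj⟩ := h S hS
    refine ⟨z, hz, Set.mem_iUnion₂.2 ⟨l j, Finset.mem_map.2 ⟨⟨l j, hl j⟩, hst ?_, rfl⟩, hzj⟩⟩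
    exact Finset.mem_image_of_mem _ (Finset.mem_univ j)

/-- An affine function whose zero set is the line through the points of the circle of radius `R`
at the angles `α` and `β`; if these points coincide it is a tangent line. For `α ≤ β ≤ α + 2π` the
function is positive on the open arc from `α` to `β`. -/
noncomputable def chord (R α β : ℝ) (z : Plane) : ℝ :=
  z 0 * Real.cos ((α + β) / 2) + z 1 * Real.sin ((α + β) / 2) - R * Real.cos ((β - α) / 2)

lemma chord_eq_zero_iff {R α β : ℝ} {z : Plane} :
    chord R α β z = 0 ↔ z ∈ normalLine ((α + β) / 2) (R * Real.cos ((β - α) / 2)) := by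
  rw [mem_normalLine, chord, sub_eq_zero]

/-- Going once around the circle from the far end of a chord reverses its orientation. -/
lemma chord_add_two_pi (R α β : ℝ) (z : Plane) :
    chord R β (α + 2 * Real.pi) z = -chord R α β z := by
  have h1 : (β + (α + 2 * Real.pi)) / 2 = (α + β) / 2 + Real.pi := by ring
  have h2 : (α + 2 * Real.pi - β) / 2 = Real.pi - (β - α) / 2 := by ring
  rw [chord, chord, h1, h2, Real.cos_add_pi, Real.sin_add_pi, Real.cos_pi_sub]
  ring

lemma mul_cos_add_mul_sin_lt {R : ℝ} {z : Plane} (hz : ‖z‖ < R) (α : ℝ) :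
    z 0 * Real.cos α + z 1 * Real.sin α < R := by
  have h1 : ‖(!₂[Real.cos α, Real.sin α] : Plane)‖ = 1 := by
    rw [EuclideanSpace.norm_eq]
    simp [Fin.sum_univ_two]
  have h2 := real_inner_le_norm (!₂[Real.cos α, Real.sin α] : Plane) z
  rw [inner_cos_sin, h1, one_mul] at h2
  linarith

/-- The caps cut off by the chords from a fixed point increase with the other end point. -/
lemma chord_nonneg_of_chord_pos {R α β γ : ℝ} {z : Plane} (hz : ‖z‖ < R) (hαβ : α ≤ β)
    (hβγ : β ≤ γ) (hγ : γ ≤ α + 2 * Real.pi) (h : 0 < chord R α β z) : 0 ≤ chord R α γ z := by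
  have hX := mul_cos_add_mul_sin_lt hz α
  -- coordinates adapted to the common end point of the chords
  set X := z 0 * Real.cos α + z 1 * Real.sin α with hXdef
  set Y := -z 0 * Real.sin α + z 1 * Real.cos α with hYdef
  have hrot : ∀ β, chord R α β z =
      Y * Real.sin ((β - α) / 2) - (R - X) * Real.cos ((β - α) / 2) := by
    intro β
    have h1 : (α + β) / 2 = α + (β - α) / 2 := by ring
    rw [chord, h1, Real.cos_add, Real.sin_add, hXdef, hYdef]
    ring
  rw [hrot] at h ⊢
  set b := (β - α) / 2 with hb
  set c := (γ - α) / 2 with hc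
  have hb0 : 0 ≤ b := by rw [hb]; linarith
  have hbc : b ≤ c := by rw [hb, hc]; linarith
  have hcpi : c ≤ Real.pi := by rw [hc]; linarith
  have hsin : 0 ≤ (R - X) * Real.sin (c - b) :=
    mul_nonneg (by linarith) (Real.sin_nonneg_of_nonneg_of_le_pi (by linarith) (by linarith))
  rw [Real.sin_sub] at hsin
  have hsc : 0 ≤ Real.sin c := Real.sin_nonneg_of_nonneg_of_le_pi (by linarith) hcpi
  rcases (Real.sin_nonneg_of_nonneg_of_le_pi hb0 (hbc.trans hcpi)).eq_or_lt with hsb | hsb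
  · rcases hb0.eq_or_lt with hb0 | hb0
    · rw [← hb0] at h
      simp at h
      linarith
    · have hbpi : b = Real.pi := by
        by_contra hne
        exact (Real.sin_pos_of_pos_of_lt_pi hb0 (lt_of_le_of_ne (hbc.trans hcpi) hne)).ne hsb
      have hcpi' : c = Real.pi := le_antisymm hcpi (hbpi ▸ hbc)
      rw [hcpi']
      simp
      linarith
  · refine nonneg_of_mul_nonneg_right (a := Real.sin b) ?_ hsb
    nlinarith [mul_nonneg hsc h.le]

/-! ### The wedges between consecutive chords -/

/-- The angle of the `m`-th of the points that divide the circle into arcs of lengths proportional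
to the coordinates of `x`. The index `m` is read cyclically, an additional turn adding `2π`. -/
noncomputable def angle {n : ℕ} [NeZero n] (x : stdSimplex ℝ (Fin n)) (m : ℕ) : ℝ :=
  2 * Real.pi * ∑ j ∈ Finset.range m, x.1 (Fin.ofNat n j)

section Angle

variable {n : ℕ} [NeZero n] (x : stdSimplex ℝ (Fin n))

lemma angle_add_card (m : ℕ) : angle x (m + n) = angle x m + 2 * Real.pi := by
  have h1 : ∑ j ∈ Finset.range n, x.1 (Fin.ofNat n j) = 1 := by
    rw [Finset.sum_range, ← x.2.2]
    exact Finset.sum_congr rfl fun i _ ↦ by simp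
  have h2 : ∀ j, Fin.ofNat n (n + j) = Fin.ofNat n j := fun j ↦ by
    ext
    simp
  rw [angle, angle, add_comm m n, Finset.sum_range_add, h1]
  simp only [h2]
  ring

lemma angle_mono : Monotone (angle x) := by
  refine monotone_nat_of_le_succ fun m ↦ ?_
  rw [angle, angle, Finset.sum_range_succ]
  have := x.2.1 (Fin.ofNat n m)
  have := Real.pi_pos
  gcongr
  linarith

lemma angle_succ_of_eq_zero {i : Fin n} (h : x.1 i = 0) : angle x (i + 1) = angle x i := by
  rw [angle, angle, Finset.sum_range_succ]
  simp [h]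

lemma continuous_angle (m : ℕ) : Continuous fun x : stdSimplex ℝ (Fin n) ↦ angle x m :=
  continuous_const.mul (continuous_finsetSum _ fun _ _ ↦
    (continuous_apply _).comp continuous_subtype_val)

end Angle

/-- The chord from the `m`-th dividing point of the circle to the opposite one, `k` steps on. -/
noncomputable def diagonal {k : ℕ} [NeZero (2 * k)] (R : ℝ) (x : stdSimplex ℝ (Fin (2 * k)))
    (m : ℕ) : Plane → ℝ :=
  chord R (angle x m) (angle x (m + k))

section Diagonal

variable {k : ℕ} [NeZero (2 * k)] {R : ℝ}

lemma diagonal_add (x : stdSimplex ℝ (Fin (2 * k))) (m : ℕ) (z : Plane) :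
    diagonal R x (m + k) z = -diagonal R x m z := by
  rw [diagonal, diagonal, add_assoc, ← two_mul, angle_add_card, chord_add_two_pi]

lemma continuous_diagonal (m : ℕ) :
    Continuous fun q : stdSimplex ℝ (Fin (2 * k)) × Plane ↦ diagonal R q.1 m q.2 := by
  have h1 : Continuous fun q : stdSimplex ℝ (Fin (2 * k)) × Plane ↦ angle q.1 m :=
    (continuous_angle m).comp continuous_fst
  have h2 : Continuous fun q : stdSimplex ℝ (Fin (2 * k)) × Plane ↦ angle q.1 (m + k) :=
    (continuous_angle (m + k)).comp continuous_fst
  unfold diagonal chord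
  fun_prop

/-- If the `i`-th arc is a point, then the wedge between the two diagonals at its ends does not
meet the disc. -/
lemma pos_of_mem_wedge {x : stdSimplex ℝ (Fin (2 * k))} {i : Fin (2 * k)} {z : Plane}
    (hz : ‖z‖ < R) (h1 : 0 < diagonal R x i z) (h2 : diagonal R x (i + 1) z < 0) :
    0 < x.1 i := by
  refine lt_of_le_of_ne (x.2.1 i) fun h ↦ ?_
  have hk : 0 < 2 * k := Nat.pos_of_ne_zero (NeZero.ne _)
  rw [diagonal, angle_succ_of_eq_zero x h.symm] at h2
  refine h2.not_ge (chord_nonneg_of_chord_pos hz (angle_mono x (by omega))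
    (angle_mono x (by omega)) ?_ h1)
  rw [← angle_add_card]
  exact angle_mono x (by omega)

end Diagonal

/-- A set lies in the `i`-th class for a sequence of functions `f` if `i` is the first index at
which the sign of `f` changes from positive to negative on the set. The conditions on the
earlier indices are stated so that they also make sense for sets on which signs vary. -/
def IsFirstDrop (f : ℕ → Plane → ℝ) (S : Set Plane) (i : ℕ) : Prop :=
  (∀ z ∈ S, 0 < f i z) ∧ (∀ z ∈ S, f (i + 1) z < 0) ∧
    ∀ j < i, (∀ z ∈ S, f j z < 0) ∨ ∀ z ∈ S, 0 < f (j + 1) z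

lemma IsFirstDrop.disjoint {f : ℕ → Plane → ℝ} {S T : Set Plane} {i j : ℕ}
    (hS : IsFirstDrop f S i) (hT : IsFirstDrop f T j) (hij : i ≠ j) : Disjoint S T := by
  wlog h : i < j generalizing S T i j
  · exact (this hT hS hij.symm (by omega)).symm
  rw [Set.disjoint_left]
  intro z hzS hzT
  rcases hT.2.2 i h with h | h
  · exact (h z hzT).not_gt (hS.1 z hzS)
  · exact (h z hzT).not_gt (hS.2.1 z hzS)

/-- A nonempty connected set that avoids the zeros of a sequence of functions with
`f (m + k) = -f m` belongs to a class, because the sequence of signs changes within a period. -/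
lemma exists_isFirstDrop {f : ℕ → Plane → ℝ} {k : ℕ} (hf : ∀ m, Continuous (f m))
    (hanti : ∀ m z, f (m + k) z = -f m z) {S : Set Plane} (hS : IsPreconnected S)
    (hne : S.Nonempty) (h0 : ∀ m, ∀ z ∈ S, f m z ≠ 0) : ∃ i < 2 * k, IsFirstDrop f S i := by
  classical
  have hsign : ∀ m, (∀ z ∈ S, 0 < f m z) ∨ ∀ z ∈ S, f m z < 0 := by
    intro m
    by_contra! h
    obtain ⟨⟨z, hz, hz'⟩, ⟨y, hy, hy'⟩⟩ := h
    obtain ⟨v, hv, hv'⟩ := hS.intermediate_value hz hy (hf m).continuousOn ⟨hz', hy'⟩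
    exact h0 m v hv hv'
  obtain ⟨s, hs⟩ := hne
  let P : ℕ → Prop := fun m ↦ ∀ z ∈ S, 0 < f m z
  have hP : ∀ m, ¬P m → ∀ z ∈ S, f m z < 0 := fun m hm ↦ (hsign m).resolve_left hm
  have hPk : ∀ m, P (m + k) ↔ ¬P m := by
    intro m
    constructor
    · intro h h'
      have := h s hs
      rw [hanti] at this
      linarith [h' s hs]
    · intro h z hz
      rw [hanti]
      linarith [hP m h z hz]
  -- two indices at distance `k` at which the sign passes from positive to negative
  have hstart : ∃ a ≤ k, P a ∧ ¬P (a + k) := by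
    by_cases h : P 0
    · exact ⟨0, Nat.zero_le _, h, fun h' ↦ (hPk 0).1 h' h⟩
    · exact ⟨k, le_rfl, by simpa using (hPk 0).2 h, fun h' ↦ (hPk k).1 h' (by
        simpa using (hPk 0).2 h)⟩
  obtain ⟨a, hak, ha, ha'⟩ := hstart
  have hdrop : ∃ i, i < 2 * k ∧ P i ∧ ¬P (i + 1) := by
    by_contra! hcon
    have : ∀ d ≤ k, P (a + d) := by
      intro d
      induction d with
      | zero => exact fun _ ↦ ha
      | succ d ih => exact fun hd ↦ hcon (a + d) (by omega) (ih (by omega))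
    exact ha' (this k le_rfl)
  obtain ⟨hlt, hpos, hneg⟩ := Nat.find_spec hdrop
  refine ⟨Nat.find hdrop, hlt, hpos, hP _ hneg, fun j hj ↦ ?_⟩
  by_cases hPj : P j
  · refine Or.inr ?_
    by_contra hPj'
    exact Nat.find_min hdrop hj ⟨by omega, hPj, hPj'⟩
  · exact Or.inl (hP j hPj)

lemma isOpen_setOf_forall_pos {X : Type*} [TopologicalSpace X] {g : X × Plane → ℝ}
    (hg : Continuous g) {S : Set Plane} (hS : IsCompact S) : IsOpen {x | ∀ z ∈ S, 0 < g (x, z)} :=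
  isOpen_iff_eventually.2 fun _ hx ↦ hS.eventually_forall_of_forall_eventually
    (P := fun x z ↦ 0 < g (x, z)) fun z hz ↦ hg.continuousAt.eventually_const_lt (hx z hz)

lemma isOpen_setOf_isFirstDrop {X : Type*} [TopologicalSpace X] {g : X → ℕ → Plane → ℝ}
    (hg : ∀ m, Continuous fun q : X × Plane ↦ g q.1 m q.2) {S : Set Plane} (hS : IsCompact S)
    (i : ℕ) : IsOpen {x | IsFirstDrop (g x) S i} := by
  have hpos : ∀ m, IsOpen {x | ∀ z ∈ S, 0 < g x m z} := fun m ↦ isOpen_setOf_forall_pos (hg m) hS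
  have hneg : ∀ m, IsOpen {x | ∀ z ∈ S, g x m z < 0} := fun m ↦ by
    simpa using isOpen_setOf_forall_pos (hg m).neg hS
  have hall : IsOpen (⋂ j ∈ Finset.range i,
      ({x | ∀ z ∈ S, g x j z < 0} ∪ {x | ∀ z ∈ S, 0 < g x (j + 1) z})) :=
    isOpen_biInter_finset fun j _ ↦ (hneg j).union (hpos (j + 1))
  convert ((hpos i).inter (hneg (i + 1))).inter hall using 1
  ext x
  simp [IsFirstDrop, and_assoc]

/-! ### Families of convex sets without disjoint transversals -/

theorem mainTheorem2 (k : ℕ) (F : Fin (2 * k) → Set (Set Plane))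
    (hfin : ∀ i, (F i).Finite)
    (hcompact : ∀ i, ∀ S ∈ F i, IsCompact S)
    (hconvex : ∀ i, ∀ S ∈ F i, Convex ℝ S)
    (hcolorful : ∀ C : Fin (2 * k) → Set Plane, (∀ i, C i ∈ F i) →
      ∃ i j, i ≠ j ∧ (C i ∩ C j).Nonempty) :
    ∃ i, PiercedByLines (F i) k := by
  rcases Nat.eq_zero_or_pos k with rfl | hk
  · obtain ⟨i, -⟩ := hcolorful (fun i ↦ absurd i.2 (by omega)) fun i ↦ absurd i.2 (by omega)
    exact absurd i.2 (by omega)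
  have : NeZero (2 * k) := ⟨by omega⟩
  by_contra! hcon
  obtain ⟨R, hR⟩ : ∃ R, ∀ c, ∀ S ∈ F c, ∀ z ∈ S, ‖z‖ < R := by
    have hbdd : Bornology.IsBounded (⋃ c, ⋃ S ∈ F c, S) :=
      (isCompact_iUnion fun c ↦ (hfin c).isCompact_biUnion (hcompact c)).isBounded
    obtain ⟨R, hR⟩ := hbdd.exists_norm_le
    exact ⟨R + 1, fun c S hS z hz ↦ lt_add_of_le_of_pos
      (hR z (Set.mem_iUnion.2 ⟨c, Set.mem_iUnion₂.2 ⟨S, hS, hz⟩⟩)) one_pos⟩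
  let A : Fin (2 * k) → Fin (2 * k) → Set (stdSimplex ℝ (Fin (2 * k))) := fun c i ↦
    ⋃ S ∈ F c, {x | IsFirstDrop (diagonal R x) S i}
  have hA : ∀ c i, IsOpen (A c i) := fun c i ↦ isOpen_biUnion fun S hS ↦
    isOpen_setOf_isFirstDrop (fun m ↦ continuous_diagonal m) (hcompact c S hS) i
  have hcover : ∀ c x, ∃ i, 0 < x.1 i ∧ x ∈ A c i := by
    intro c x
    obtain ⟨S, hS, hmiss⟩ : ∃ S ∈ F c, ∀ j : Fin k, ∀ z ∈ S, diagonal R x j z ≠ 0 := by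
      by_contra! h
      refine hcon c (piercedByLines_of_forall_fin (fun j : Fin k ↦
        normalLine ((angle x j + angle x (j + k)) / 2)
          (R * Real.cos ((angle x (j + k) - angle x j) / 2)))
        (fun j ↦ isLine_normalLine _ _) fun S hS ↦ ?_)
      obtain ⟨j, z, hz, hzj⟩ := h S hS
      exact ⟨j, z, hz, chord_eq_zero_iff.1 hzj⟩
    rcases S.eq_empty_or_nonempty with rfl | hne
    · -- the empty set belongs to every class
      obtain ⟨i, -, hi⟩ : ∃ i ∈ Finset.univ, 0 < x.1 i :=
        (Finset.sum_pos_iff_of_nonneg fun i _ ↦ x.2.1 i).1 (by rw [x.2.2]; exact one_pos)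
      exact ⟨i, hi, Set.mem_iUnion₂.2 ⟨∅, hS, by simp [IsFirstDrop]⟩⟩
    have h0 : ∀ m, ∀ z ∈ S, diagonal R x m z ≠ 0 := by
      intro m
      induction m using Nat.strong_induction_on with
      | _ m ih =>
        by_cases hm : m < k
        · exact hmiss ⟨m, hm⟩
        · intro z hz
          have := ih (m - k) (by omega) z hz
          rw [← Nat.sub_add_cancel (not_lt.1 hm), diagonal_add]
          exact neg_ne_zero.2 this
    obtain ⟨i, hi, hdrop⟩ := exists_isFirstDrop
      (fun m ↦ (continuous_diagonal m).comp (Continuous.prodMk_right x))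
      (diagonal_add x) (hconvex c S hS).isPreconnected hne h0
    obtain ⟨z, hz⟩ := hne
    exact ⟨⟨i, hi⟩, pos_of_mem_wedge (hR c S hS z hz) (hdrop.1 z hz) (hdrop.2.1 z hz),
      Set.mem_iUnion₂.2 ⟨S, hS, hdrop⟩⟩
  obtain ⟨x, π, hx⟩ := exists_perm_forall_mem_of_open_covers hA hcover
  choose C hC hdrop using fun c ↦ Set.mem_iUnion₂.1 (hx c)
  obtain ⟨i, j, hij, z, hzi, hzj⟩ := hcolorful C hC
  refine Set.disjoint_left.1 ((hdrop i).disjoint (hdrop j) fun h ↦ hij ?_) hzi hzj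
  exact π.injective (Fin.ext h)
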